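/- All graphs are finite and simple. The cycle space of a graph $G$ is the subspace of $\mathbb{F}_2^{E(G)}$ formed by the edge sets in which every vertex has even degree. The basis number $\mathrm{bn}(G)$ is the minimum, over all bases $\mathcal{B}$ of the cycle space, of $\max_{e\in E(G)} |\{X\in\mathcal{B} : e\in X\}|$ (which is read as $0$ if $E(G)=\emptyset$). A path-decomposition of $G$ is a sequence $X_1,\dots,X_m$ ($m \ge 1$) of subsets of $V(G)$, called bags, such that every vertex lies in some bag, both ends of every edge lie in a common bag, and for every vertex $v$ the indices $i$ with $v\in X_i$ form an interval. It has adhesion at most $k$ if $|X_i\cap X_{i+1}|\le k$ for all $1\le i<m$. Its width is $\max_i |X_i|-1$, and the pathwidth of $G$ is the minimum width of a path-decomposition of $G$. **Theorem.** (1) There is an absolute constant $C$ such that the following holds for all integers $b\ge 1$ and $k\ge 0$. Let $G$ be a graph with a path-decomposition $X_1,\dots,X_m$ of adhesion at most $k$ such that $\mathrm{bn}(G[A])\le b$ for every $i$ and every subset $A\subseteq X_i$. Then $$\mathrm{bn}(G)\le b\cdot 2^{2^{C k^2}}.$$ (2) There is an absolute constant $C$ such that for every integer $k\ge 0$, every graph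 $G$ of pathwidth at most $k$ satisfies $$\mathrm{bn}(G)\le 2^{2^{C k^2}}.$$ -/

import Mathlib

universe u

/-- The cycle space of a finite graph `G`, as a subspace of the `𝔽₂`-vector space of sets of edges.
A set of edges is encoded by its indicator function `x : Sym2 V → ZMod 2`, which vanishes outside
`E(G)`. The sum `∑ᶠ w, x s(v, w)` is the degree modulo 2 of `v` in the corresponding subgraph
(the term `w = v` vanishes, since a loop is not an edge), so `x` lies in the cycle space exactly
if all degrees are even. -/
noncomputable def cycleSpace {V : Type u} [Finite V] (G : SimpleGraph V) :
    Submodule (ZMod 2) (Sym2 V → ZMod 2) where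
  carrier := {x | (∀ e, e ∉ G.edgeSet → x e = 0) ∧ ∀ v, ∑ᶠ w, x s(v, w) = 0}
  zero_mem' := by simp
  add_mem' := by
    rintro x y ⟨hx, hx'⟩ ⟨hy, hy'⟩
    refine ⟨fun e he => by simp [hx e he, hy e he], fun v => ?_⟩
    have h := finsum_add_distrib (f := fun w => x s(v, w)) (g := fun w => y s(v, w))
      (Set.toFinite _) (Set.toFinite _)
    simpa [hx' v, hy' v] using h
  smul_mem' := by
    rintro c x ⟨hx, hx'⟩
    refine ⟨fun e he => by simp [hx e he], fun v => ?_⟩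
    have h := smul_finsum' c (f := fun w => x s(v, w)) (Set.toFinite _)
    simpa [hx' v] using h.symm

/-- `B` is a cycle basis of `G`: a basis of the cycle space of `G` over `𝔽₂`. -/
def IsCycleBasis {V : Type u} [Finite V] (G : SimpleGraph V) (B : Set (Sym2 V → ZMod 2)) : Prop :=
  LinearIndepOn (ZMod 2) id B ∧ Submodule.span (ZMod 2) B = cycleSpace G

/-- The edge-congestion of a set `B` of (indicator functions of) edge sets of `G`: the maximum over
the edges `e` of `G` of the number of members of `B` that contain `e` (and `0` if `G` has no
edge). -/
noncomputable def edgeCongestion {V : Type u} (G : SimpleGraph V) (B : Set (Sym2 V → ZMod 2)) : ℕ :=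
  ⨆ e : G.edgeSet, {x ∈ B | x e ≠ 0}.ncard

/-- The basis number of a finite graph: the minimum edge-congestion of a cycle basis. -/
noncomputable def basisNumber {V : Type u} [Finite V] (G : SimpleGraph V) : ℕ :=
  sInf {c | ∃ B, IsCycleBasis G B ∧ edgeCongestion G B = c}

/-- The minimum in `basisNumber` is over a nonempty set. -/
theorem exists_isCycleBasis {V : Type u} [Finite V] (G : SimpleGraph V) :
    ∃ B, IsCycleBasis G B := by
  obtain ⟨B, hB, hspan, hli⟩ :=
    exists_linearIndependent (ZMod 2) (cycleSpace G : Set (Sym2 V → ZMod 2))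
  exact ⟨B, hli, by rw [hspan, Submodule.span_eq]⟩

/-- A path-decomposition of `G`. The nodes of the path are `0, 1, …, last`, in this order. -/
structure PathDecomposition {V : Type u} (G : SimpleGraph V) where
  /-- the last node of the path -/
  last : ℕ
  /-- the bag of each node -/
  bag : Fin (last + 1) → Set V
  /-- every vertex lies in some bag -/
  exists_mem_bag : ∀ v, ∃ t, v ∈ bag t
  /-- both ends of every edge lie in a common bag -/
  exists_mem_bag_of_adj : ∀ v w, G.Adj v w → ∃ t, v ∈ bag t ∧ w ∈ bag t
  /-- the nodes whose bags contain a given vertex form a subpath -/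
  ordConnected : ∀ v, Set.OrdConnected {t | v ∈ bag t}

/-- The path-decomposition has adhesion at most `k`: any two consecutive bags share at most `k`
vertices. -/
def PathDecomposition.AdhesionAtMost {V : Type u} {G : SimpleGraph V} (D : PathDecomposition G)
    (k : ℕ) : Prop :=
  ∀ i : Fin D.last, (D.bag i.castSucc ∩ D.bag i.succ).ncard ≤ k

/-- The width of a path-decomposition of a finite graph: the maximum size of a bag, minus one.
(If all bags are empty this is `0` rather than `-1`.) -/
noncomputable def PathDecomposition.width {V : Type u} {G : SimpleGraph V}
    (D : PathDecomposition G) : ℕ :=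
  (⨆ t, (D.bag t).ncard) - 1

/-- The pathwidth of a finite graph: the minimum width of a path-decomposition. -/
noncomputable def pathwidth {V : Type u} (G : SimpleGraph V) : ℕ :=
  sInf {w | ∃ D : PathDecomposition G, D.width = w}

/-- The minimum in `pathwidth` is over a nonempty set: the whole vertex set is a single bag. -/
theorem nonempty_pathDecomposition {V : Type u} (G : SimpleGraph V) :
    Nonempty (PathDecomposition G) :=
  ⟨⟨0, fun _ => Set.univ, fun _ => ⟨0, trivial⟩, fun _ _ _ => ⟨0, trivial, trivial⟩,
    fun _ => Set.ordConnected_univ⟩⟩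

/-!
Let `G` have a path-decomposition of adhesion at most `k` whose bags induce graphs of basis number
at most `b`. The proof gives the bound `b * 2 ^ k ^ 2 + 2 * k` for the basis number of `G`
(`PathDecomposition.basisNumber_le`), which is far below the doubly exponential one. Since a basis
can be extracted from any generating set, it suffices to generate the cycle space `Z` with low
congestion.

Give each edge as its level the index of the first bag that contains it. For a set `P` of levels let
`Z_P` be the space of cycles with all levels in `P`. For each `s < t` choose a set `B s t` of cycles
that is a basis of `Z_[s, t]` modulo `Z_(s, t] + Z_[s, t)`, that is, modulo the cycles that start
later or end earlier, and let `B s s` generate `Z_{s}`. By induction on `t - s`, these sets together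
generate `Z`.

The chosen cycles that use an edge of level `j` are in `B j j`, or in some `B s t` with `s ≤ j < t`,
or in some `B s t` with `s ≤ j - 1 < t`. The point is that at most `k` chosen cycles cross a given
cut between `j` and `j + 1` (`ncard_crossing_le`). Truncate a cycle to the levels up to `j`: the
result has even degree outside the at most `k` vertices of the separator, so its degrees form a
vector in `𝔽₂ ^ k`. For the crossing chosen cycles these vectors are linearly independent. For in a
vanishing combination, the cut splits the sum `y` into two cycles. Let `t` be the largest last level
that occurs, let `s` be the smallest first level that occurs together with `t`, and let `z` be the
part of the sum in `B s t`. Both `y` and `y - z` lie in `Z_(s, ∞) + Z_[0, t)`; so does `z`, and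
hence `z` lies in `Z_(s, t] + Z_[s, t)`, contrary to the choice of `B s t`.

It remains to generate the cycles of level `j`: these are the cycles of the graph induced by the bag
`j` that avoid its at most `k ^ 2` edges of smaller level. Deleting one edge at most doubles the
congestion (`exists_span_eq_inf_ker_proj`), whence the factor `2 ^ k ^ 2`.

A graph of pathwidth at most `k` has a path-decomposition of adhesion at most `k + 1` whose bags
induce graphs of basis number at most `(k + 1) ^ 2`, since the cycle space has at most this
dimension. This gives the second bound for `k ≥ 1`; for `k = 0` there are no edges.
-/

/-! ### Spanning sets of low congestion -/

section LinearAlgebra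

variable {K E : Type*} [Field K]

/-- Every coordinate is nonzero in at most `c` members of `B`. -/
def CongestionAtMost (B : Set (E → K)) (c : ℕ) : Prop :=
  ∀ e, {x ∈ B | x e ≠ 0}.ncard ≤ c

/-- Intersecting a subspace with a coordinate hyperplane `x e₀ = 0` at most doubles the congestion:
one generator that is nonzero at `e₀` is used to clear the coordinate `e₀` of the at most `c`
generators that are nonzero there. -/
theorem exists_span_eq_inf_ker_proj [Finite K] [Finite E] {B : Set (E → K)} {c : ℕ}
    (hB : CongestionAtMost B c) (e₀ : E) :
    ∃ B' : Set (E → K), CongestionAtMost B' (2 * c) ∧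
      Submodule.span K B' = Submodule.span K B ⊓ LinearMap.ker (LinearMap.proj e₀) := by
  by_cases h : ∃ x₀ ∈ B, x₀ e₀ ≠ 0
  · obtain ⟨x₀, hx₀, hne⟩ := h
    let f : (E → K) →ₗ[K] (E → K) :=
      LinearMap.id - (LinearMap.toSpanSingleton K (E → K) x₀).comp
        ((x₀ e₀)⁻¹ • LinearMap.proj e₀)
    have hf : ∀ x, f x = x - ((x₀ e₀)⁻¹ * x e₀) • x₀ := fun x => by simp [f]
    refine ⟨f '' B, fun e => ?_, ?_⟩
    · have hsub : {y ∈ f '' B | y e ≠ 0} ⊆ f '' ({x ∈ B | x e ≠ 0} ∪ {x ∈ B | x e₀ ≠ 0}) := by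
        rintro _ ⟨⟨x, hx, rfl⟩, hy⟩
        refine ⟨x, ?_, rfl⟩
        by_contra hcon
        simp only [Set.mem_union, Set.mem_ofPred_eq, hx, true_and, not_or, not_not] at hcon
        exact hy (by simp [hf, hcon.1, hcon.2])
      calc _ ≤ (f '' ({x ∈ B | x e ≠ 0} ∪ {x ∈ B | x e₀ ≠ 0})).ncard :=
            Set.ncard_le_ncard hsub (Set.toFinite _)
        _ ≤ ({x ∈ B | x e ≠ 0} ∪ {x ∈ B | x e₀ ≠ 0}).ncard := Set.ncard_image_le (Set.toFinite _)
        _ ≤ _ := Set.ncard_union_le _ _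
        _ ≤ 2 * c := by have := hB e; have := hB e₀; omega
    · rw [Submodule.span_image]
      ext y
      simp only [Submodule.mem_map, Submodule.mem_inf, LinearMap.mem_ker, LinearMap.proj_apply]
      constructor
      · rintro ⟨x, hx, rfl⟩
        refine ⟨?_, by simp [hf]; field_simp; simp⟩
        rw [hf]
        exact sub_mem hx (Submodule.smul_mem _ _ (Submodule.subset_span hx₀))
      · rintro ⟨hy, hy0⟩
        exact ⟨y, hy, by simp [hf, hy0]⟩
  · push Not at h
    refine ⟨B, fun e => (hB e).trans (by omega), (inf_eq_left.2 ?_).symm⟩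
    rw [Submodule.span_le]
    exact fun x hx => h x hx

theorem exists_span_eq_inf_vanishing [Finite K] [Finite E] {B : Set (E → K)} {c : ℕ}
    (hB : CongestionAtMost B c) (D : Finset E) :
    ∃ B' : Set (E → K), CongestionAtMost B' (c * 2 ^ D.card) ∧
      ∀ x, x ∈ Submodule.span K B' ↔ x ∈ Submodule.span K B ∧ ∀ e ∈ D, x e = 0 := by
  classical
  induction D using Finset.induction_on with
  | empty => exact ⟨B, by simpa using hB, by simp⟩
  | insert e₀ D he₀ ih =>
    obtain ⟨B₁, hc₁, hs₁⟩ := ih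
    obtain ⟨B₂, hc₂, hs₂⟩ := exists_span_eq_inf_ker_proj hc₁ e₀
    refine ⟨B₂, ?_, fun x => ?_⟩
    · rw [Finset.card_insert_of_notMem he₀, pow_succ]
      convert hc₂ using 1
      ring
    · rw [hs₂, Submodule.mem_inf, hs₁]
      simp [and_comm, and_left_comm]

/-! ### Gluing along a linear order of the coordinates -/

/-- The vectors of `Z` whose support consists of coordinates with level in `P`. -/
def supportedOn (Z : Submodule K (E → K)) (τ : E → ℕ) (P : Set ℕ) : Submodule K (E → K) where
  carrier := {x | x ∈ Z ∧ ∀ e, x e ≠ 0 → τ e ∈ P}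
  zero_mem' := by simp
  add_mem' := by
    rintro x y ⟨hx, hx'⟩ ⟨hy, hy'⟩
    refine ⟨Z.add_mem hx hy, fun e he => ?_⟩
    by_cases h : x e = 0
    · exact hy' e fun h' => he (by simp [h, h'])
    · exact hx' e h
  smul_mem' := by
    rintro a x ⟨hx, hx'⟩
    exact ⟨Z.smul_mem a hx, fun e he => hx' e fun h => he (by simp [h])⟩

theorem mem_supportedOn {Z : Submodule K (E → K)} {τ : E → ℕ} {P : Set ℕ} {x : E → K} :
    x ∈ supportedOn Z τ P ↔ x ∈ Z ∧ ∀ e, x e ≠ 0 → τ e ∈ P := Iff.rfl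

theorem supportedOn_mono (Z : Submodule K (E → K)) (τ : E → ℕ) {P Q : Set ℕ} (h : P ⊆ Q) :
    supportedOn Z τ P ≤ supportedOn Z τ Q :=
  fun _ hx => ⟨hx.1, fun e he => h (hx.2 e he)⟩

theorem supportedOn_inf (Z : Submodule K (E → K)) (τ : E → ℕ) (P Q : Set ℕ) :
    supportedOn Z τ P ⊓ supportedOn Z τ Q = supportedOn Z τ (P ∩ Q) := by
  ext x
  simp only [Submodule.mem_inf, mem_supportedOn, Set.mem_inter_iff]
  exact ⟨fun h => ⟨h.1.1, fun e he => ⟨h.1.2 e he, h.2.2 e he⟩⟩,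
    fun h => ⟨⟨h.1, fun e he => (h.2 e he).1⟩, h.1, fun e he => (h.2 e he).2⟩⟩

/-- The coordinates of level at most `j` are kept, the others are set to `0`. -/
def truncate (K : Type*) [Field K] {E : Type*} (τ : E → ℕ) (j : ℕ) : (E → K) →ₗ[K] (E → K) where
  toFun x e := if τ e ≤ j then x e else 0
  map_add' x y := by ext e; by_cases h : τ e ≤ j <;> simp [h]
  map_smul' a x := by ext e; by_cases h : τ e ≤ j <;> simp [h]

theorem truncate_apply (τ : E → ℕ) (j : ℕ) (x : E → K) (e : E) :
    truncate K τ j x e = if τ e ≤ j then x e else 0 := rfl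

theorem mem_sup_of_truncate_mem {Z : Submodule K (E → K)} {τ : E → ℕ} {j : ℕ} {x : E → K}
    {P : Set ℕ} (hx : x ∈ supportedOn Z τ P) (h : truncate K τ j x ∈ Z) :
    x ∈ supportedOn Z τ (P ∩ Set.Iic j) ⊔ supportedOn Z τ (P ∩ Set.Ioi j) := by
  refine Submodule.mem_sup.2 ⟨truncate K τ j x, ⟨h, fun e he => ?_⟩, x - truncate K τ j x,
    ⟨Z.sub_mem hx.1 h, fun e he => ?_⟩, by abel⟩
  · rw [truncate_apply] at he
    split_ifs at he with hj
    · exact ⟨hx.2 e he, hj⟩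
    · exact absurd rfl he
  · rw [Pi.sub_apply, truncate_apply] at he
    split_ifs at he with hj
    · simp at he
    · exact ⟨hx.2 e (by simpa using he), not_le.1 hj⟩

/-- A basis of a subspace modulo a smaller one, lifted to the subspace. -/
theorem exists_linearIndepOn_mkQ_sup_eq {M : Type*} [AddCommGroup M] [Module K M]
    {W Y : Submodule K M} (h : W ≤ Y) :
    ∃ B : Set M, LinearIndepOn K W.mkQ B ∧ Submodule.span K B ⊔ W = Y := by
  obtain ⟨B, hBY, -, hspan, hli⟩ := exists_linearIndepOn_extension (K := K) (v := W.mkQ)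
    (s := ∅) (t := (Y : Set M)) (linearIndepOn_empty _ _) (Set.empty_subset _)
  refine ⟨B, hli, le_antisymm (sup_le (Submodule.span_le.2 hBY) h) fun y hy => ?_⟩
  have := hspan ⟨y, hy, rfl⟩
  rw [Submodule.span_image, SetLike.mem_coe, ← Submodule.mem_comap, Submodule.comap_map_mkQ,
    sup_comm] at this
  exact this

/-- The vectors of `Z` supported on levels in `[s, t]` that are already generated by vectors
supported on shorter intervals of levels. -/
def shorter (Z : Submodule K (E → K)) (τ : E → ℕ) (s t : ℕ) : Submodule K (E → K) :=
  supportedOn Z τ (Set.Ioc s t) ⊔ supportedOn Z τ (Set.Ico s t)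

theorem shorter_le (Z : Submodule K (E → K)) (τ : E → ℕ) (s t : ℕ) :
    shorter Z τ s t ≤ supportedOn Z τ (Set.Icc s t) :=
  sup_le (supportedOn_mono _ _ Set.Ioc_subset_Icc_self)
    (supportedOn_mono _ _ Set.Ico_subset_Icc_self)

/-- If `B s t` generates the vectors supported on levels in `[s, t]` modulo `shorter Z τ s t`,
then all the sets `B s t` together generate. -/
theorem supportedOn_Icc_le_span {Z : Submodule K (E → K)} {τ : E → ℕ}
    {B : ℕ → ℕ → Set (E → K)}
    (hB : ∀ s t, s < t → supportedOn Z τ (Set.Icc s t) ≤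
      Submodule.span K (B s t) ⊔ shorter Z τ s t)
    (hB' : ∀ s, supportedOn Z τ {s} ≤ Submodule.span K (B s s)) (d : ℕ) :
    ∀ s, supportedOn Z τ (Set.Icc s (s + d)) ≤
      Submodule.span K {x | ∃ s t, s ≤ t ∧ x ∈ B s t} := by
  have hmono : ∀ s t, s ≤ t → Submodule.span K (B s t) ≤
      Submodule.span K {x | ∃ s t, s ≤ t ∧ x ∈ B s t} :=
    fun s t hst => Submodule.span_mono fun x hx => ⟨s, t, hst, hx⟩
  induction d with
  | zero =>
    intro s
    rw [Nat.add_zero, Set.Icc_self]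
    exact (hB' s).trans (hmono s s le_rfl)
  | succ d ih =>
    intro s
    refine (hB s (s + (d + 1)) (by omega)).trans
      (sup_le (hmono _ _ (by omega)) (sup_le ?_ ?_))
    · refine le_trans (supportedOn_mono _ _ fun i hi => ?_) (ih (s + 1))
      simp only [Set.mem_Ioc, Set.mem_Icc] at hi ⊢
      omega
    · refine le_trans (supportedOn_mono _ _ fun i hi => ?_) (ih s)
      simp only [Set.mem_Ico, Set.mem_Icc] at hi ⊢
      omega

/-- At most `k` of the chosen vectors cross the cut between the levels `j` and `j + 1`, if `k`
linear conditions on a vector of `Z` ensure that the cut splits it into two vectors of `Z`.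

The images of the crossing vectors under these conditions are linearly independent. In a
vanishing combination, consider the vectors whose last level `t` is maximal and, among them,
those whose first level `s` is minimal. The cut splits the whole combination, so their part of it
lies in `shorter Z τ s t`, and the vectors of `B s t` are independent modulo this subspace. -/
theorem ncard_crossing_le {Z : Submodule K (E → K)} {τ : E → ℕ}
    [Finite K] [Finite E] {B : ℕ → ℕ → Set (E → K)} {k j : ℕ}
    (hBZ : ∀ s t, s < t → B s t ⊆ supportedOn Z τ (Set.Icc s t))
    (hli : ∀ s t, s < t → LinearIndepOn K (shorter Z τ s t).mkQ (B s t))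
    {N : Type*} [AddCommGroup N] [Module K N] [Module.Finite K N]
    (φ : (E → K) →ₗ[K] N) (hN : Module.finrank K N ≤ k)
    (hφ : ∀ x ∈ Z, φ x = 0 → truncate K τ j x ∈ Z) :
    {x | ∃ s t, s ≤ j ∧ j < t ∧ x ∈ B s t}.ncard ≤ k := by
  classical
  set U : Set (E → K) := {x | ∃ s t, s ≤ j ∧ j < t ∧ x ∈ B s t} with hU
  have hUex : ∀ x : U, ∃ s t, s ≤ j ∧ j < t ∧ (x : E → K) ∈ B s t := fun x => x.2
  choose s t hs ht hB using hUex
  have : Fintype U := Fintype.ofFinite U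
  suffices h : LinearIndependent K (fun x : U => φ x) by
    have := h.fintype_card_le_finrank
    rw [← Nat.card_eq_fintype_card, Nat.card_coe_set_eq] at this
    exact this.trans hN
  rw [Fintype.linearIndependent_iff]
  intro g hg
  by_contra! hne
  -- the lexicographic order makes the last level maximal, then the first level minimal
  obtain ⟨a, ha, hmax⟩ := Finset.exists_max_image (Finset.univ.filter fun x : U => g x ≠ 0)
    (fun x => toLex (t x, j - s x)) (by obtain ⟨i, hi⟩ := hne; exact ⟨i, by simpa using hi⟩)
  simp only [Finset.mem_filter, Finset.mem_univ, true_and] at ha hmax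
  have hmax' : ∀ x : U, g x ≠ 0 → t x < t a ∨ t x = t a ∧ s a ≤ s x := by
    intro x hx
    have := hmax x hx
    rw [Prod.Lex.toLex_le_toLex] at this
    have := hs x
    have := hs a
    simp only at *
    omega
  have hst : s a < t a := (hs a).trans_lt (ht a)
  have hxZ : ∀ x : U, (x : E → K) ∈ supportedOn Z τ (Set.Icc (s x) (t x)) :=
    fun x => hBZ _ _ ((hs x).trans_lt (ht x)) (hB x)
  set p : U → Prop := fun x => s x = s a ∧ t x = t a with hp
  set y : E → K := ∑ x : U, g x • (x : E → K) with hy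
  set z : E → K := ∑ x ∈ Finset.univ.filter p, g x • (x : E → K) with hz
  have hyt : y ∈ supportedOn Z τ (Set.Iic (t a)) := by
    refine Submodule.sum_mem _ fun x _ => ?_
    by_cases hx : g x = 0
    · simp [hx]
    · refine Submodule.smul_mem _ _ (supportedOn_mono _ _ (fun i hi => ?_) (hxZ x))
      have := hmax' x hx
      simp only [Set.mem_Icc, Set.mem_Iic] at hi ⊢
      omega
  have hφy : φ y = 0 := by simpa [hy] using hg
  -- the cut splits `y`
  have hy2 : y ∈ supportedOn Z τ (Set.Ioc (s a) (t a)) ⊔ supportedOn Z τ (Set.Iio (t a)) := by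
    have h := mem_sup_of_truncate_mem hyt (hφ y hyt.1 hφy)
    rw [sup_comm] at h
    have := hs a
    have := ht a
    refine SetLike.le_def.1 (sup_le_sup (supportedOn_mono _ _ fun i hi => ?_)
      (supportedOn_mono _ _ fun i hi => ?_)) h
    · simp only [Set.mem_inter_iff, Set.mem_Iic, Set.mem_Ioi, Set.mem_Ioc] at hi ⊢
      omega
    · simp only [Set.mem_inter_iff, Set.mem_Iic, Set.mem_Iio] at hi ⊢
      omega
  -- the part of `y` outside `B (s a) (t a)` starts later or ends earlier
  have hyz : y - z ∈ supportedOn Z τ (Set.Ioc (s a) (t a)) ⊔ supportedOn Z τ (Set.Iio (t a)) := by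
    have : y - z = ∑ x ∈ Finset.univ.filter (fun x => ¬ p x), g x • (x : E → K) := by
      rw [hy, hz, ← Finset.sum_filter_add_sum_filter_not Finset.univ p]
      abel
    rw [this]
    refine Submodule.sum_mem _ fun x hx => ?_
    simp only [hp, Finset.mem_filter, Finset.mem_univ, true_and] at hx
    by_cases hgx : g x = 0
    · simp [hgx]
    refine Submodule.smul_mem _ _ ?_
    rcases hmax' x hgx with h | ⟨h, h'⟩
    · refine Submodule.mem_sup_right (supportedOn_mono _ _ (fun i hi => ?_) (hxZ x))
      simp only [Set.mem_Icc, Set.mem_Iio] at hi ⊢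
      omega
    · refine Submodule.mem_sup_left (supportedOn_mono _ _ (fun i hi => ?_) (hxZ x))
      simp only [Set.mem_Icc, Set.mem_Ioc] at hi ⊢
      omega
  have hz1 : z ∈ supportedOn Z τ (Set.Icc (s a) (t a)) := by
    refine Submodule.sum_mem _ fun x hx => Submodule.smul_mem _ _ ?_
    simp only [hp, Finset.mem_filter, Finset.mem_univ, true_and] at hx
    rw [← hx.1, ← hx.2]
    exact hxZ x
  -- by the modular law, the summand of `z` that ends before `t a` also starts at `s a` or later
  have hz2 : z ∈ shorter Z τ (s a) (t a) := by
    have h : z ∈ supportedOn Z τ (Set.Ioc (s a) (t a)) ⊔ supportedOn Z τ (Set.Iio (t a)) := by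
      have := Submodule.sub_mem _ hy2 hyz
      rwa [sub_sub_cancel] at this
    have h2 := Submodule.mem_inf.2 ⟨h, hz1⟩
    rw [sup_inf_assoc_of_le _ (supportedOn_mono _ _ Set.Ioc_subset_Icc_self),
      supportedOn_inf] at h2
    refine SetLike.le_def.1 (sup_le_sup_left (supportedOn_mono _ _ fun i hi => ?_) _) h2
    simp only [Set.mem_inter_iff, Set.mem_Icc, Set.mem_Iio, Set.mem_Ico] at hi ⊢
    omega
  have hinj : LinearIndependent K
      (fun x : {x : U // p x} => (shorter Z τ (s a) (t a)).mkQ (x : U)) := by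
    refine (hli _ _ hst).comp (fun x : {x : U // p x} =>
      (⟨x.1.1, by have := hB x.1; rwa [x.2.1, x.2.2] at this⟩ : B (s a) (t a))) ?_
    intro x x' hxx
    exact Subtype.ext (Subtype.ext (Subtype.mk.inj hxx))
  rw [Fintype.linearIndependent_iff] at hinj
  refine ha (hinj (fun x => g x) ?_ ⟨a, rfl, rfl⟩)
  rw [← Submodule.Quotient.mk_eq_zero, ← Submodule.mkQ_apply, hz, map_sum,
    ← Finset.sum_subtype_eq_sum_filter, Finset.subtype_univ] at hz2
  simpa using hz2

/-- **Gluing lemma.** Suppose that each cut between consecutive levels is described by at most `k`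
linear conditions, and that the vectors of `Z` supported on a single level have a generating set of
congestion at most `c`. Then `Z` has a generating set of congestion at most `c + 2 * k`. -/
theorem exists_span_eq_congestionAtMost [Finite K] [Finite E] (Z : Submodule K (E → K))
    (τ : E → ℕ) {k c : ℕ} {N : ℕ → Type*} [∀ j, AddCommGroup (N j)] [∀ j, Module K (N j)]
    [∀ j, Module.Finite K (N j)] (φ : ∀ j, (E → K) →ₗ[K] N j)
    (hN : ∀ j, Module.finrank K (N j) ≤ k)
    (hφ : ∀ j, ∀ x ∈ Z, φ j x = 0 → truncate K τ j x ∈ Z)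
    (hloc : ∀ j, ∃ B : Set (E → K), CongestionAtMost B c ∧
      Submodule.span K B = supportedOn Z τ {j}) :
    ∃ B : Set (E → K), CongestionAtMost B (c + 2 * k) ∧ Submodule.span K B = Z := by
  choose L hLc hLs using hloc
  choose M hMli hMs using fun s t => exists_linearIndepOn_mkQ_sup_eq (shorter_le Z τ s t)
  let B : ℕ → ℕ → Set (E → K) := fun s t => if s = t then L s else M s t
  have hBs : ∀ s, B s s = L s := fun s => by simp [B]
  have hBM : ∀ s t, s < t → B s t = M s t := fun s t h => by simp [B, h.ne]
  have hBZ : ∀ s t, s ≤ t → B s t ⊆ supportedOn Z τ (Set.Icc s t) := by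
    intro s t hst
    rcases hst.eq_or_lt with rfl | hst
    · rw [hBs, Set.Icc_self, ← hLs]
      exact Submodule.subset_span
    · rw [hBM s t hst, ← hMs]
      exact Submodule.subset_span.trans (le_sup_left (a := Submodule.span K (M s t)))
  have hcross : ∀ j, {x | ∃ s t, s ≤ j ∧ j < t ∧ x ∈ B s t}.ncard ≤ k := fun j =>
    ncard_crossing_le (fun s t h => hBZ s t h.le) (fun s t h => hBM s t h ▸ hMli s t) (φ j) (hN j)
      (hφ j)
  refine ⟨{x | ∃ s t, s ≤ t ∧ x ∈ B s t}, fun e => ?_, le_antisymm ?_ ?_⟩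
  · -- a vector that uses a coordinate of level `j` is local, or ends after `j`, or ends at `j`
    -- and hence crosses the cut before `j`
    set j := τ e with hj
    have hsub : {x ∈ {x | ∃ s t, s ≤ t ∧ x ∈ B s t} | x e ≠ 0} ⊆
        ({x ∈ L j | x e ≠ 0} ∪ {x | ∃ s t, s ≤ j ∧ j < t ∧ x ∈ B s t}) ∪
          {x | ∃ s t, s ≤ j - 1 ∧ j - 1 < t ∧ x ∈ B s t} := by
      rintro x ⟨⟨s, t, hst, hx⟩, hxe⟩
      have hmem := (hBZ s t hst hx).2 e hxe
      rw [Set.mem_Icc, ← hj] at hmem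
      rcases hmem.2.lt_or_eq with h | h
      · exact Or.inl (Or.inr ⟨s, t, hmem.1, h, hx⟩)
      rcases hmem.1.lt_or_eq with h' | h'
      · exact Or.inr ⟨s, t, by omega, by omega, hx⟩
      · obtain rfl : s = t := h'.trans h
        rw [h', hBs] at *
        exact Or.inl (Or.inl ⟨hx, hxe⟩)
    have h1 := Set.ncard_le_ncard hsub (Set.toFinite _)
    have h2 := Set.ncard_union_le
      ({x ∈ L j | x e ≠ 0} ∪ {x | ∃ s t, s ≤ j ∧ j < t ∧ x ∈ B s t})
      {x | ∃ s t, s ≤ j - 1 ∧ j - 1 < t ∧ x ∈ B s t}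
    have h3 := Set.ncard_union_le {x ∈ L j | x e ≠ 0} {x | ∃ s t, s ≤ j ∧ j < t ∧ x ∈ B s t}
    have := hLc j e
    have := hcross j
    have := hcross (j - 1)
    omega
  · rw [Submodule.span_le]
    rintro x ⟨s, t, hst, hx⟩
    exact (hBZ s t hst hx).1
  · obtain ⟨n, hn⟩ := (Set.toFinite (Set.range τ)).bddAbove
    have hZ : Z ≤ supportedOn Z τ (Set.Icc 0 (0 + n)) :=
      fun x hx => ⟨hx, fun e _ => ⟨Nat.zero_le _, by simpa using hn ⟨e, rfl⟩⟩⟩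
    refine hZ.trans
      (supportedOn_Icc_le_span (Z := Z) (τ := τ) (B := B) (fun s t h => ?_) (fun s => ?_) n 0)
    · rw [hBM s t h, hMs]
    · rw [hBs, hLs]

end LinearAlgebra

/-! ### Generating sets of cycle spaces -/

section CycleSpace

variable {V : Type u}

theorem basisNumber_le_of_span_eq [Finite V] {G : SimpleGraph V} {B : Set (Sym2 V → ZMod 2)}
    {c : ℕ} (hB : CongestionAtMost B c) (hspan : Submodule.span (ZMod 2) B = cycleSpace G) :
    basisNumber G ≤ c := by
  obtain ⟨B', hsub, hspan', hli⟩ := exists_linearIndependent (ZMod 2) B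
  have h : edgeCongestion G B' ≤ c := by
    refine ciSup_le' fun e => ?_
    have hle : {x ∈ B' | x (e : Sym2 V) ≠ 0} ⊆ {x ∈ B | x (e : Sym2 V) ≠ 0} :=
      fun x hx => ⟨hsub hx.1, hx.2⟩
    exact (Set.ncard_le_ncard hle (Set.toFinite _)).trans (hB e)
  exact le_trans (Nat.sInf_le ⟨B', ⟨hli, hspan'.trans hspan⟩, rfl⟩) h

theorem exists_span_eq_cycleSpace [Finite V] (G : SimpleGraph V) :
    ∃ B : Set (Sym2 V → ZMod 2), CongestionAtMost B (basisNumber G) ∧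
      Submodule.span (ZMod 2) B = cycleSpace G := by
  obtain ⟨B₀, hB₀⟩ := exists_isCycleBasis G
  obtain ⟨B, hB, hc⟩ := Nat.sInf_mem (s := {c | ∃ B, IsCycleBasis G B ∧ edgeCongestion G B = c})
    ⟨_, B₀, hB₀, rfl⟩
  refine ⟨B, fun e => ?_, hB.2⟩
  change _ ≤ sInf {c | ∃ B, IsCycleBasis G B ∧ edgeCongestion G B = c}
  rw [← hc]
  by_cases he : e ∈ G.edgeSet
  · exact le_ciSup (f := fun e : G.edgeSet => {x ∈ B | x (e : Sym2 V) ≠ 0}.ncard)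
      (Set.finite_range _).bddAbove ⟨e, he⟩
  · have : {x ∈ B | x e ≠ 0} = ∅ := by
      refine Set.eq_empty_of_forall_notMem fun x hx => hx.2 ?_
      have hxZ : x ∈ cycleSpace G := hB.2 ▸ Submodule.subset_span hx.1
      exact hxZ.1 e he
    simp [this]

theorem basisNumber_le_card_sq [Finite V] (G : SimpleGraph V) : basisNumber G ≤ Nat.card V ^ 2 := by
  classical
  have := Fintype.ofFinite V
  obtain ⟨B, hB⟩ := exists_isCycleBasis G
  have := Fintype.ofFinite B
  refine basisNumber_le_of_span_eq (fun e => ?_) hB.2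
  have h1 : {x ∈ B | x e ≠ 0}.ncard ≤ B.ncard :=
    Set.ncard_le_ncard (fun x hx => hx.1) (Set.toFinite _)
  have h2 : Fintype.card B ≤ Fintype.card (Sym2 V) := by
    simpa using LinearIndependent.fintype_card_le_finrank hB.1
  have h3 : Fintype.card (Sym2 V) ≤ Fintype.card (V × V) :=
    Fintype.card_le_of_surjective _ (Sym2.mk_surjective (α := V))
  rw [← Nat.card_coe_set_eq B, Nat.card_eq_fintype_card] at h1
  rw [Fintype.card_prod] at h3
  rw [Nat.card_eq_fintype_card, sq]
  omega

/-! ### Induced subgraphs -/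

theorem mem_range_sym2Map_val {A : Set V} {e : Sym2 V} :
    e ∈ Set.range (Sym2.map (Subtype.val : A → V)) ↔ ∀ v ∈ e, v ∈ A := by
  constructor
  · rintro ⟨e, rfl⟩ v hv
    obtain ⟨w, -, rfl⟩ := Sym2.mem_map.1 hv
    exact w.2
  · induction e using Sym2.ind with
    | _ v w =>
      intro h
      exact ⟨s(⟨v, h v (by simp)⟩, ⟨w, h w (by simp)⟩), rfl⟩

/-- A set of edges on `A` is viewed as a set of edges on `V`. -/
noncomputable def extendEdges (A : Set V) : (Sym2 A → ZMod 2) →ₗ[ZMod 2] (Sym2 V → ZMod 2) :=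
  Function.ExtendByZero.linearMap (ZMod 2) (Sym2.map Subtype.val)

theorem extendEdges_map (A : Set V) (x : Sym2 A → ZMod 2) (e : Sym2 A) :
    extendEdges A x (e.map Subtype.val) = x e :=
  (Sym2.map.injective Subtype.val_injective).extend_apply _ _ _

theorem extendEdges_of_notMem {A : Set V} (x : Sym2 A → ZMod 2) {e : Sym2 V}
    (h : ¬ ∀ v ∈ e, v ∈ A) : extendEdges A x e = 0 :=
  Function.extend_apply' _ _ _ fun ⟨e', he'⟩ => h (mem_range_sym2Map_val.1 ⟨e', he'⟩)

theorem extendEdges_mem_cycleSpace [Finite V] {G : SimpleGraph V} {A : Set V}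
    {x : Sym2 A → ZMod 2} :
    extendEdges A x ∈ cycleSpace G ↔ x ∈ cycleSpace (G.induce A) := by
  have hedge : ∀ e : Sym2 A, e.map Subtype.val ∈ G.edgeSet ↔ e ∈ (G.induce A).edgeSet := by
    intro e
    induction e using Sym2.ind with
    | _ v w => simp
  have hdeg : ∀ v : A, ∑ᶠ w, extendEdges A x s((v : V), w) = ∑ᶠ w, x s(v, w) := by
    intro v
    have h1 : ∀ w : A, x s(v, w) = extendEdges A x s((v : V), (w : V)) := fun w =>
      (extendEdges_map A x s(v, w)).symm
    rw [finsum_congr h1, finsum_set_coe_eq_finsum_mem (f := fun w => extendEdges A x s((v : V), w))]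
    refine finsum_congr fun w => ?_
    by_cases hw : w ∈ A
    · simp [hw]
    · rw [extendEdges_of_notMem x fun h => hw (h w (by simp))]
      simp
  constructor
  · rintro ⟨h1, h2⟩
    refine ⟨fun e he => ?_, fun v => ?_⟩
    · rw [← extendEdges_map A x e]
      exact h1 _ fun h => he ((hedge e).1 h)
    · rw [← hdeg]
      exact h2 v
  · rintro ⟨h1, h2⟩
    refine ⟨fun e he => ?_, fun v => ?_⟩
    · by_cases h : ∀ v ∈ e, v ∈ A
      · obtain ⟨e, rfl⟩ := mem_range_sym2Map_val.2 h
        rw [extendEdges_map]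
        exact h1 _ fun h => he ((hedge e).2 h)
      · exact extendEdges_of_notMem x h
    · by_cases hv : v ∈ A
      · rw [hdeg ⟨v, hv⟩]
        exact h2 _
      · exact finsum_eq_zero_of_forall_eq_zero fun w =>
          extendEdges_of_notMem x fun h => hv (h v (by simp))

/-- The cycles of `G` inside `A` are generated with congestion at most `bn(G[A])`. -/
theorem exists_mem_span_iff_support_subset [Finite V] (G : SimpleGraph V) (A : Set V) :
    ∃ B : Set (Sym2 V → ZMod 2), CongestionAtMost B (basisNumber (G.induce A)) ∧
      ∀ x, x ∈ Submodule.span (ZMod 2) B ↔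
        x ∈ cycleSpace G ∧ ∀ e, x e ≠ 0 → ∀ v ∈ e, v ∈ A := by
  obtain ⟨B, hc, hs⟩ := exists_span_eq_cycleSpace (G.induce A)
  refine ⟨extendEdges A '' B, fun e => ?_, fun x => ?_⟩
  · by_cases h : ∀ v ∈ e, v ∈ A
    · obtain ⟨e, rfl⟩ := mem_range_sym2Map_val.2 h
      refine le_trans (Set.ncard_le_ncard ?_ (Set.toFinite _))
        ((Set.ncard_image_le (f := extendEdges A) (Set.toFinite _)).trans (hc e))
      rintro _ ⟨⟨x, hx, rfl⟩, hxe⟩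
      rw [extendEdges_map] at hxe
      exact ⟨x, ⟨hx, hxe⟩, rfl⟩
    · have : {x ∈ extendEdges A '' B | x e ≠ 0} = ∅ := by
        refine Set.eq_empty_of_forall_notMem ?_
        rintro _ ⟨⟨x, hx, rfl⟩, hxe⟩
        exact hxe (extendEdges_of_notMem x h)
      rw [this, Set.ncard_empty]
      exact Nat.zero_le _
  · rw [Submodule.span_image, hs, Submodule.mem_map]
    constructor
    · rintro ⟨x, hx, rfl⟩
      exact ⟨extendEdges_mem_cycleSpace.2 hx, fun e he => by
        by_contra h
        exact he (extendEdges_of_notMem x h)⟩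
    · rintro ⟨hx, hxA⟩
      have hext : extendEdges A (fun e => x (e.map Subtype.val)) = x := by
        funext e
        by_cases h : ∀ v ∈ e, v ∈ A
        · obtain ⟨e, rfl⟩ := mem_range_sym2Map_val.2 h
          rw [extendEdges_map]
        · rw [extendEdges_of_notMem _ h]
          by_contra h0
          exact h (hxA e (Ne.symm h0))
      exact ⟨_, extendEdges_mem_cycleSpace.1 (hext.symm ▸ hx), hext⟩

end CycleSpace

/-! ### Path-decompositions -/

namespace PathDecomposition

variable {V : Type u} {G : SimpleGraph V} (D : PathDecomposition G)

/-- The first node whose bag contains both ends of `e` (and `0` if there is none). -/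
noncomputable def level (e : Sym2 V) : ℕ :=
  sInf {i | ∃ t : Fin (D.last + 1), (t : ℕ) = i ∧ ∀ v ∈ e, v ∈ D.bag t}

/-- The vertices that lie both in a bag up to `j` and in a bag after `j`. -/
def separator (j : ℕ) : Set V :=
  {v | ∃ s t : Fin (D.last + 1), (s : ℕ) ≤ j ∧ j < (t : ℕ) ∧ v ∈ D.bag s ∧ v ∈ D.bag t}

variable {D}

theorem level_le {e : Sym2 V} {t : Fin (D.last + 1)} (h : ∀ v ∈ e, v ∈ D.bag t) :
    D.level e ≤ t :=
  Nat.sInf_le ⟨t, rfl, h⟩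

theorem exists_level_eq {e : Sym2 V} (h : ∃ t, ∀ v ∈ e, v ∈ D.bag t) :
    ∃ t : Fin (D.last + 1), (t : ℕ) = D.level e ∧ ∀ v ∈ e, v ∈ D.bag t := by
  obtain ⟨t, ht⟩ := h
  exact Nat.sInf_mem (s := {i | ∃ t : Fin (D.last + 1), (t : ℕ) = i ∧ ∀ v ∈ e, v ∈ D.bag t})
    ⟨t, t, rfl, ht⟩

theorem exists_bag_of_mem_edgeSet {e : Sym2 V} (he : e ∈ G.edgeSet) :
    ∃ t, ∀ v ∈ e, v ∈ D.bag t := by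
  induction e using Sym2.ind with
  | _ v w =>
    obtain ⟨t, hv, hw⟩ := D.exists_mem_bag_of_adj v w he
    exact ⟨t, by simp [hv, hw]⟩

theorem ncard_separator_le [Finite V] {k : ℕ} (hD : D.AdhesionAtMost k) (j : ℕ) :
    (D.separator j).ncard ≤ k := by
  by_cases hj : j < D.last
  · refine (Set.ncard_le_ncard ?_ (Set.toFinite _)).trans (hD ⟨j, hj⟩)
    rintro v ⟨s, t, hs, ht, hvs, hvt⟩
    refine ⟨(D.ordConnected v).out hvs hvt ⟨?_, ?_⟩, (D.ordConnected v).out hvs hvt ⟨?_, ?_⟩⟩ <;>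
      simp only [Fin.le_def, Fin.val_castSucc, Fin.val_succ] <;> omega
  · have : D.separator j = ∅ := by
      refine Set.eq_empty_of_forall_notMem ?_
      rintro v ⟨s, t, hs, ht, -⟩
      have := t.2
      omega
    simp [this]

theorem ncard_bag_le (D : PathDecomposition G) (t : Fin (D.last + 1)) :
    (D.bag t).ncard ≤ D.width + 1 := by
  have := le_ciSup (f := fun t => (D.bag t).ncard) (Set.finite_range _).bddAbove t
  unfold width
  omega

variable [Finite V]

/-- The degrees modulo 2, at the vertices of the separator after `j`, of the edges of level at most
`j` in an edge set. -/
noncomputable def cutDegree (D : PathDecomposition G) (j : ℕ) :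
    (Sym2 V → ZMod 2) →ₗ[ZMod 2] (D.separator j → ZMod 2) where
  toFun x v := ∑ᶠ w, truncate (ZMod 2) D.level j x s((v : V), w)
  map_add' x y := by
    funext v
    simpa using finsum_add_distrib (Set.toFinite _) (Set.toFinite _)
  map_smul' a x := by
    funext v
    simpa only [map_smul, Pi.smul_apply, RingHom.id_apply] using
      (smul_finsum' a (Set.toFinite _)).symm

theorem cutDegree_apply (j : ℕ) (x : Sym2 V → ZMod 2) (v : D.separator j) :
    D.cutDegree j x v = ∑ᶠ w, truncate (ZMod 2) D.level j x s((v : V), w) := rfl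

/-- At a vertex outside the separator after `j`, all edges are on the same side of the cut, so a
cycle is split into cycles as soon as the degrees at the separator are even. -/
theorem truncate_mem_cycleSpace {j : ℕ} {x : Sym2 V → ZMod 2} (hx : x ∈ cycleSpace G)
    (h : D.cutDegree j x = 0) : truncate (ZMod 2) D.level j x ∈ cycleSpace G := by
  refine ⟨fun e he => by simp [truncate_apply, hx.1 e he], fun v => ?_⟩
  by_cases hv : v ∈ D.separator j
  · exact (cutDegree_apply j x ⟨v, hv⟩).symm.trans (congrFun h ⟨v, hv⟩)
  by_cases hlow : ∃ s : Fin (D.last + 1), (s : ℕ) ≤ j ∧ v ∈ D.bag s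
  · obtain ⟨s, hs, hvs⟩ := hlow
    rw [← hx.2 v]
    refine finsum_congr fun w => ?_
    rw [truncate_apply]
    split_ifs with hj
    · rfl
    by_cases he : s(v, w) ∈ G.edgeSet
    · obtain ⟨t, ht, hvt⟩ := exists_level_eq (exists_bag_of_mem_edgeSet (D := D) he)
      exact absurd ⟨s, t, hs, by omega, hvs, hvt v (by simp)⟩ hv
    · exact (hx.1 _ he).symm
  · refine finsum_eq_zero_of_forall_eq_zero fun w => ?_
    rw [truncate_apply]
    split_ifs with hj
    · by_cases he : s(v, w) ∈ G.edgeSet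
      · obtain ⟨t, ht, hvt⟩ := exists_level_eq (exists_bag_of_mem_edgeSet (D := D) he)
        exact absurd ⟨t, by omega, hvt v (by simp)⟩ hlow
      · exact hx.1 _ he
    · rfl

/-- The edges inside the bag `t` that already lie in an earlier bag have both ends in the
separator before `t`, so there are at most `k ^ 2` of them. -/
theorem ncard_level_lt_le {k : ℕ} (hD : D.AdhesionAtMost k) (t : Fin (D.last + 1)) :
    {e : Sym2 V | (∀ v ∈ e, v ∈ D.bag t) ∧ D.level e < t}.ncard ≤ k ^ 2 := by
  set S := D.separator (t - 1)
  have hsub : {e : Sym2 V | (∀ v ∈ e, v ∈ D.bag t) ∧ D.level e < t} ⊆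
      (fun p : V × V => s(p.1, p.2)) '' (S ×ˢ S) := by
    rintro e ⟨he, hlt⟩
    obtain ⟨s, hs, hes⟩ := exists_level_eq ⟨t, he⟩
    have hS : ∀ v ∈ e, v ∈ S := fun v hv =>
      ⟨s, t, by omega, by omega, hes v hv, he v hv⟩
    induction e using Sym2.ind with
    | _ v w => exact ⟨(v, w), ⟨hS v (by simp), hS w (by simp)⟩, rfl⟩
  calc _ ≤ _ := Set.ncard_le_ncard hsub (Set.toFinite _)
    _ ≤ (S ×ˢ S).ncard := Set.ncard_image_le (Set.toFinite _)
    _ = S.ncard * S.ncard := Set.ncard_prod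
    _ ≤ k * k := Nat.mul_le_mul (ncard_separator_le hD _) (ncard_separator_le hD _)
    _ = k ^ 2 := (sq k).symm

theorem exists_span_eq_supportedOn_level {k b : ℕ} (hD : D.AdhesionAtMost k)
    (hb : ∀ t, basisNumber (G.induce (D.bag t)) ≤ b) (j : ℕ) :
    ∃ B : Set (Sym2 V → ZMod 2), CongestionAtMost B (b * 2 ^ k ^ 2) ∧
      Submodule.span (ZMod 2) B = supportedOn (cycleSpace G) D.level {j} := by
  by_cases hj : j < D.last + 1
  · set t : Fin (D.last + 1) := ⟨j, hj⟩ with ht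
    obtain ⟨B, hc, hs⟩ := exists_mem_span_iff_support_subset G (D.bag t)
    have hfin := Set.toFinite {e : Sym2 V | (∀ v ∈ e, v ∈ D.bag t) ∧ D.level e < t}
    obtain ⟨B', hc', hs'⟩ := exists_span_eq_inf_vanishing hc hfin.toFinset
    refine ⟨B', fun e => (hc' e).trans (Nat.mul_le_mul (hb t) ?_), ?_⟩
    · rw [← Set.ncard_eq_toFinset_card _ hfin]
      exact Nat.pow_le_pow_right (by norm_num) (ncard_level_lt_le hD t)
    ext x
    rw [hs', hs, mem_supportedOn, and_assoc]
    refine and_congr_right fun hx => ⟨fun ⟨h1, h2⟩ e he => ?_, fun h => ⟨fun e he => ?_, ?_⟩⟩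
    · have hle := level_le (h1 e he)
      by_contra hne
      exact he (h2 e (hfin.mem_toFinset.2 ⟨h1 e he, lt_of_le_of_ne hle hne⟩))
    · have hedge : e ∈ G.edgeSet := by
        by_contra hcon
        exact he (hx.1 e hcon)
      obtain ⟨s, hs, hes⟩ := exists_level_eq (exists_bag_of_mem_edgeSet (D := D) hedge)
      have : s = t := Fin.ext (hs.trans (h e he))
      rwa [this] at hes
    · intro e he
      by_contra hne
      exact (hfin.mem_toFinset.1 he).2.ne (h e hne)
  · refine ⟨∅, fun e => by simp, ?_⟩
    rw [Submodule.span_empty, eq_comm, Submodule.eq_bot_iff]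
    rintro x ⟨hx, hxj⟩
    funext e
    by_contra he
    have hedge : e ∈ G.edgeSet := by
      by_contra hcon
      exact he (hx.1 e hcon)
    obtain ⟨s, hs, -⟩ := exists_level_eq (exists_bag_of_mem_edgeSet (D := D) hedge)
    have h1 : D.level e = j := hxj e he
    have := s.2
    omega

/-- The basis number grows under gluing along a path-decomposition of adhesion `k` at most by the
factor `2 ^ k ^ 2` and the summand `2 * k`. -/
theorem basisNumber_le {k b : ℕ} (hD : D.AdhesionAtMost k)
    (hb : ∀ t, basisNumber (G.induce (D.bag t)) ≤ b) :
    basisNumber G ≤ b * 2 ^ k ^ 2 + 2 * k := by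
  have hN : ∀ j, Module.finrank (ZMod 2) (D.separator j → ZMod 2) ≤ k := fun j => by
    have := Fintype.ofFinite (D.separator j)
    rw [Module.finrank_fintype_fun_eq_card, ← Nat.card_eq_fintype_card, Nat.card_coe_set_eq]
    exact ncard_separator_le hD j
  obtain ⟨B, hc, hs⟩ := exists_span_eq_congestionAtMost (cycleSpace G) D.level D.cutDegree hN
    (fun j x hx h => truncate_mem_cycleSpace hx h) (exists_span_eq_supportedOn_level hD hb)
  exact basisNumber_le_of_span_eq hc hs

end PathDecomposition

/-! ### The doubly exponential bounds -/

theorem mul_two_pow_add_le {b k : ℕ} (hb : 1 ≤ b) :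
    b * 2 ^ k ^ 2 + 2 * k ≤ b * 2 ^ 2 ^ (2 * k ^ 2) := by
  rcases Nat.eq_zero_or_pos k with rfl | hk
  · simp; omega
  set n := k ^ 2 with hn
  have hkn : k ≤ n := by nlinarith
  have h1 : n < 2 ^ n := Nat.lt_two_pow_self
  have h2 : n + 2 ≤ 2 ^ (2 * n) := by
    rw [two_mul, pow_add]
    nlinarith
  calc b * 2 ^ n + 2 * k ≤ b * 2 ^ n + b * (2 * 2 ^ n) := by
        have := Nat.mul_le_mul hb (show 2 * k ≤ 2 * 2 ^ n by omega)
        omega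
    _ ≤ b * 2 ^ (n + 2) := by
        rw [← mul_add]
        refine Nat.mul_le_mul_left b ?_
        rw [pow_add]
        omega
    _ ≤ _ := Nat.mul_le_mul_left b (Nat.pow_le_pow_right (by norm_num) h2)

theorem sq_mul_two_pow_add_le {k : ℕ} (hk : 1 ≤ k) :
    (k + 1) ^ 2 * 2 ^ (k + 1) ^ 2 + 2 * (k + 1) ≤ 2 ^ 2 ^ (8 * k ^ 2) := by
  set n := (k + 1) ^ 2 with hn
  have hnk : n ≤ 4 * k ^ 2 := by nlinarith
  have hkn : k + 1 ≤ n := by nlinarith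
  have h1 : n < 2 ^ n := Nat.lt_two_pow_self
  have h2 : 2 ≤ 2 ^ n := by omega
  have h3 : 2 * n + 1 ≤ 2 ^ (2 * n) := Nat.lt_two_pow_self
  calc n * 2 ^ n + 2 * (k + 1) ≤ 2 ^ n * 2 ^ n + 2 ^ n * 2 ^ n :=
        Nat.add_le_add (Nat.mul_le_mul_right _ h1.le) (Nat.mul_le_mul h2 (by omega))
    _ = 2 ^ (2 * n + 1) := by ring
    _ ≤ 2 ^ 2 ^ (2 * n) := Nat.pow_le_pow_right (by norm_num) h3
    _ ≤ 2 ^ 2 ^ (8 * k ^ 2) := Nat.pow_le_pow_right (by norm_num)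
        (Nat.pow_le_pow_right (by norm_num) (by omega))

theorem mainTheorem5 :
    (∃ C : ℕ, ∀ b k : ℕ, 1 ≤ b →
      ∀ (V : Type u) [Finite V] (G : SimpleGraph V) (D : PathDecomposition G),
        D.AdhesionAtMost k →
        (∀ t, ∀ A ⊆ D.bag t, basisNumber (G.induce A) ≤ b) →
        basisNumber G ≤ b * 2 ^ (2 ^ (C * k ^ 2))) ∧
    (∃ C : ℕ, ∀ k : ℕ, ∀ (V : Type u) [Finite V] (G : SimpleGraph V),
      pathwidth G ≤ k → basisNumber G ≤ 2 ^ (2 ^ (C * k ^ 2))) := by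
  refine ⟨⟨2, fun b k hb V _ G D hD h => ?_⟩, ⟨8, fun k V _ G hG => ?_⟩⟩
  · exact (D.basisNumber_le hD fun t => h t _ subset_rfl).trans (mul_two_pow_add_le hb)
  · obtain ⟨D₀⟩ := nonempty_pathDecomposition G
    obtain ⟨D, hD⟩ := Nat.sInf_mem (s := {w | ∃ D : PathDecomposition G, D.width = w})
      ⟨_, D₀, rfl⟩
    have hbag : ∀ t, (D.bag t).ncard ≤ k + 1 := fun t =>
      (D.ncard_bag_le t).trans (Nat.succ_le_succ (hD.trans_le hG))
    rcases Nat.eq_zero_or_pos k with rfl | hk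
    · -- all bags have at most one vertex, so there are no edges
      have hno : ∀ e, e ∉ G.edgeSet := by
        intro e
        induction e using Sym2.ind with
        | _ v w =>
          intro he
          obtain ⟨t, hv, hw⟩ := D.exists_mem_bag_of_adj v w he
          exact G.ne_of_adj he ((Set.ncard_le_one (Set.toFinite _)).1 (hbag t) v hv w hw)
      refine le_trans (basisNumber_le_of_span_eq (c := 0) (B := cycleSpace G) (fun e => ?_)
        (Submodule.span_eq _)) (Nat.zero_le _)
      have : {x ∈ (cycleSpace G : Set (Sym2 V → ZMod 2)) | x e ≠ 0} = ∅ :=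
        Set.eq_empty_of_forall_notMem fun x hx => hx.2 (hx.1.1 e (hno e))
      rw [this, Set.ncard_empty]
    · refine (D.basisNumber_le (k := k + 1) (b := (k + 1) ^ 2) (fun i => ?_) fun t => ?_).trans
        (sq_mul_two_pow_add_le hk)
      · exact (Set.ncard_le_ncard Set.inter_subset_left (Set.toFinite _)).trans (hbag _)
      · refine (basisNumber_le_card_sq _).trans (Nat.pow_le_pow_left ?_ 2)
        rw [Nat.card_coe_set_eq]
        exact hbag t
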